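/- **Setting.** Let $N\ge 1$, let $I\subseteq[0,\infty)$ be an interval containing $0$, let $\Lambda$ be a Hermitian $N\times N$ matrix, let $S$ be a real symmetric $N\times N$ matrix (its entries may have any sign), and let $z_t\in\mathbb C$ $(t\in I)$ satisfy $\eta_t:=\operatorname{Im} z_t>0$. For an $N\times N$ matrix $X$ let $\mathcal S(X)$ be the diagonal matrix with $\mathcal S(X)_{ii}=\sum_j S_{ij}X_{jj}$. Assume that $M$ is an $N\times N$ complex matrix, independent of $t$, with $$M=\big(\Lambda-z_t-t\,\mathcal S(M)\big)^{-1}\qquad\text{for all }t\in I .$$ Put $M(+)=M$, $M(-)=M^*$, and let $F_a$ be the $N\times N$ matrix whose only non-zero entry is $(F_a)_{aa}=1$. **Primitive loops.** For every $\mathfrak n\ge 2$, $\boldsymbol\sigma=(\sigma_1,\dots,\sigma_{\mathfrak n})\in\{+,-\}^{\mathfrak n}$ and $\mathbf a=(a_1,\dots,a_{\mathfrak n})\in\{1,\dots,N\}^{\mathfrak n}$, let $\widehat{\mathcal K}^{(\mathfrak n)}_{t,\boldsymbol\sigma,\mathbf a}$ $(t\in I)$ be the solution on $I$ of the system $$\partial_t\widehat{\mathcal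 K}^{(\mathfrak n)}_{t,\boldsymbol\sigma,\mathbf a}=\sum_{1\le k<\ell\le\mathfrak n}\ \sum_{c,d=1}^N \widehat{\mathcal K}^{(\mathfrak n+k-\ell+1)}_{t,(\sigma_1,\dots,\sigma_k,\sigma_\ell,\dots,\sigma_{\mathfrak n}),(a_1,\dots,a_{k-1},c,a_\ell,\dots,a_{\mathfrak n})}\;S_{cd}\;\widehat{\mathcal K}^{(\ell-k+1)}_{t,(\sigma_k,\dots,\sigma_\ell),(a_k,\dots,a_{\ell-1},d)}$$ with the initial condition $$\widehat{\mathcal K}^{(\mathfrak n)}_{0,\boldsymbol\sigma,\mathbf a}=\operatorname{Tr}\prod_{i=1}^{\mathfrak n}\big(M(\sigma_i)F_{a_i}\big).$$ **Corollary 4.3 (Ward's identity for primitive loops).** For every $t\in I$, $\mathfrak n\ge 2$, $\mathbf a=(a_1,\dots,a_{\mathfrak n})\in\{1,\dots,N\}^{\mathfrak n}$ and $\boldsymbol\sigma\in\{+,-\}^{\mathfrak n-1}$, $$\frac{1}{2\mathrm i\eta_t}\Big(\widehat{\mathcal K}^{(\mathfrak n)}_{t,(+,\boldsymbol\sigma),\mathbf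 a}-\widehat{\mathcal K}^{(\mathfrak n)}_{t,(-,\boldsymbol\sigma),\mathbf a}\Big)=\sum_{a_{\mathfrak n+1}=1}^N\widehat{\mathcal K}^{(\mathfrak n+1)}_{t,(+,\boldsymbol\sigma,-),(\mathbf a,a_{\mathfrak n+1})}.$$ -/

import Mathlib

/-- The charges `+` and `-`. -/
inductive Charge where
  | plus : Charge
  | minus : Charge

namespace PrimitiveLoop

/-- `chargedMatrix M σ` is `M(σ)`: `M(+) = M` and `M(-) = M*`, the conjugate transpose. -/
def chargedMatrix {ι : Type*} (M : Matrix ι ι ℂ) : Charge → Matrix ι ι ℂ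
  | Charge.plus => M
  | Charge.minus => M.conjTranspose

/-- The matrix `F_a`, whose only non-zero entry is `(F_a)_{aa} = 1`. -/
def siteMatrix {ι : Type*} [DecidableEq ι] (a : ι) : Matrix ι ι ℂ :=
  Matrix.single a a 1

/-- The linear operator `𝓢`: `𝓢(X)` is diagonal, with entries `𝓢(X)_{ii} = ∑_j S_{ij} X_{jj}`. -/
def selfEnergy {ι : Type*} [Fintype ι] [DecidableEq ι] (S : Matrix ι ι ℝ) (X : Matrix ι ι ℂ) :
    Matrix ι ι ℂ :=
  Matrix.diagonal fun i => ∑ j, (S i j : ℂ) * X j j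

/-- The general assumption on the time set `I`: `Λ` is Hermitian, `S` is symmetric, `z_t` lies in
the open upper half plane, and the time-independent matrix `M` is the inverse of
`Λ - z_t - t 𝓢(M)` at every time `t ∈ I`. -/
structure GeneralAssumption {ι : Type*} [Fintype ι] [DecidableEq ι] (I : Set ℝ)
    (Λ : Matrix ι ι ℂ) (S : Matrix ι ι ℝ) (z : ℝ → ℂ) (M : Matrix ι ι ℂ) : Prop where
  hermitian : Λ.IsHermitian
  symmetric : S.IsSymm
  upper : ∀ t ∈ I, 0 < (z t).im
  equation : ∀ t ∈ I,
    M * (Λ - z t • (1 : Matrix ι ι ℂ) - (t : ℂ) • selfEnergy S M) = 1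

/-- The `M`-loop `Tr ∏_{i=1}^n (M(σ_i) F_{a_i})`, for `σ = [σ_1, …, σ_n]` and
`a = [a_1, …, a_n]`. -/
def mLoop {ι : Type*} [Fintype ι] [DecidableEq ι] (M : Matrix ι ι ℂ) (σ : List Charge)
    (a : List ι) : ℂ :=
  (List.zipWith (fun s x => chargedMatrix M s * siteMatrix x) σ a).prod.trace

/-- Left cut of the charges: `(σ_1, …, σ_k, σ_l, …, σ_n)`. -/
def cutLeftCharges (k l : ℕ) (σ : List Charge) : List Charge :=
  σ.take k ++ σ.drop (l - 1)

/-- Left cut of the vertices: `(a_1, …, a_{k-1}, c, a_l, …, a_n)`. -/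
def cutLeftVertices {ι : Type*} (k l : ℕ) (c : ι) (a : List ι) : List ι :=
  a.take (k - 1) ++ [c] ++ a.drop (l - 1)

/-- Right cut of the charges: `(σ_k, …, σ_l)`. -/
def cutRightCharges (k l : ℕ) (σ : List Charge) : List Charge :=
  (σ.drop (k - 1)).take (l - k + 1)

/-- Right cut of the vertices: `(a_k, …, a_{l-1}, d)`. -/
def cutRightVertices {ι : Type*} (k l : ℕ) (d : ι) (a : List ι) : List ι :=
  (a.drop (k - 1)).take (l - k) ++ [d]

/-- The right-hand side of the primitive equation for the loop of length `n = a.length`: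
`∑_{1 ≤ k < l ≤ n} ∑_{c, d} K(left cut) S_{cd} K(right cut)`. -/
def primitiveRHS {ι : Type*} [Fintype ι] (S : Matrix ι ι ℝ) (K : List Charge → List ι → ℂ)
    (σ : List Charge) (a : List ι) : ℂ :=
  ∑ l ∈ Finset.Icc 1 a.length, ∑ k ∈ Finset.Ico 1 l, ∑ c, ∑ d,
    K (cutLeftCharges k l σ) (cutLeftVertices k l c a) * (S c d : ℂ) *
      K (cutRightCharges k l σ) (cutRightVertices k l d a)

/-- `K` is the family of primitive loops on the time set `I` (an interval starting at `0`):
`K t σ a`, for `σ` and `a` of a common length `n ≥ 2`, solves the system of primitive equations on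
`I`, and its value at time `0` is the `M`-loop. The values of `K` on lists of different lengths, or
of length less than two, carry no meaning and enter none of these conditions. -/
structure IsPrimitiveLoops {ι : Type*} [Fintype ι] [DecidableEq ι] (I : Set ℝ)
    (S : Matrix ι ι ℝ) (M : Matrix ι ι ℂ) (K : ℝ → List Charge → List ι → ℂ) : Prop where
  initial : ∀ (σ : List Charge) (a : List ι), 2 ≤ a.length → σ.length = a.length →
    K 0 σ a = mLoop M σ a
  primitive : ∀ (σ : List Charge) (a : List ι), 2 ≤ a.length → σ.length = a.length →
    ∀ t ∈ I, HasDerivWithinAt (fun s => K s σ a) (primitiveRHS S (K t) σ a) I t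

end PrimitiveLoop

/-! The primitive equations are a polynomial ODE system in which each cut splits a loop of length
`n` into two loops of lengths at most `n`. Hence the loops of length at most `N` form a closed
finite system, and any finite family of functions whose derivatives are combinations of the family
itself, with coefficients built from loops, vanishes identically as soon as it vanishes at time `0`
(`eq_zero_of_deriv_isBigO`, a form of Grönwall's inequality). This is used twice.

*Cyclic invariance* (`IsLoopFamily.rotate`). A cut of a loop at two of its edges does not depend on
where the loop starts, except that the left and the right part may be exchanged, which `S`
being symmetric allows. So the differences between the loops and their rotations form such a family.

*Ward's identity* (`IsLoopFamily.ward`). Consider the defect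
`E_t(σ, a) = K_t(+σ, a) - K_t(-σ, a) - w_t ∑_b K_t(+σ-, ab)` with `w_t = 2iη_t`.
At time `0` it vanishes, because `M - M* = w_0 M* M` for a resolvent of a Hermitian matrix. When
`K_t(+σ-, ab)` is cut, the part containing the final pair `(-, b)`, summed over `b`, is again a
Ward sum, and these match the cuts of `K_t(+σ, a) - K_t(-σ, a)` up to a rotation of one factor. The
one cut without a counterpart splits off `K_t(+-, cb)`. It is matched once loops of length one are
admitted, with the constant values `M(σ)_{aa}`: at length one the identity reads
`M_{cc} - M*_{cc} = w_t ∑_b K_t(+-, cb)`, and the left-hand side, averaged with `S`, gives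
`κ = ∑_c S_{dc} (M_{cc} - M*_{cc})`, minus the slope of `w_t`. That `κ` does not depend on `d`, and
that `w_t = w_0 - t κ`, follows from the equation for `M` because `M` does not depend on `t`
(`GeneralAssumption.exists_slope`).

Positions in the lists are counted from `0` below, so that the cut at `i < j` is the cut of
`primitiveRHS` at `k = i + 1`, `l = j + 1`. -/

open Filter Asymptotics

namespace PrimitiveLoop

/-! ### Uniqueness for finite linear systems -/

/-- Uniqueness for homogeneous linear systems. The condition `hO` says that each derivative is
bounded by the functions of the family: a combination of them with bounded coefficients satisfies
it, whatever the coefficients are. -/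
theorem eq_zero_of_deriv_isBigO {X : Type*} {P : Set X} (hP : P.Finite) {T : ℝ}
    {f f' : X → ℝ → ℂ}
    (hd : ∀ x ∈ P, ∀ t ∈ Set.Icc 0 T, HasDerivWithinAt (f x) (f' x t) (Set.Icc 0 T) t)
    (h0 : ∀ x ∈ P, f x 0 = 0)
    (hO : ∀ g : ℝ → ℝ, (∀ x ∈ P, f x =O[𝓟 (Set.Icc 0 T)] g) →
      ∀ x ∈ P, f' x =O[𝓟 (Set.Icc 0 T)] g) :
    ∀ x ∈ P, ∀ t ∈ Set.Icc 0 T, f x t = 0 := by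
  have : Fintype P := hP.fintype
  let F : ℝ → P → ℂ := fun t x => f x t
  let F' : ℝ → P → ℂ := fun t x => f' x t
  have hF : ∀ t ∈ Set.Icc 0 T, HasDerivWithinAt F (F' t) (Set.Icc 0 T) t := fun t ht =>
    hasDerivWithinAt_pi.2 fun x => hd x x.2 t ht
  have hFO : F' =O[𝓟 (Set.Icc 0 T)] fun t => ‖F t‖ :=
    isBigO_pi.2 fun x => hO _ (fun y hy =>
      (isBigO_pi.1 (isBigO_refl F _) ⟨y, hy⟩).norm_right) x x.2
  obtain ⟨C, hC⟩ := isBigO_principal.1 hFO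
  have hF0 := eq_zero_of_abs_deriv_le_mul_abs_self_of_eq_zero_right (f := F) (f' := F') (K := C)
    (a := 0) (b := T) (fun t ht => (hF t ht).continuousWithinAt)
    (fun t ht => (hF t ⟨ht.1, ht.2.le⟩).mono_of_mem_nhdsWithin (Icc_mem_nhdsGE_of_mem ht))
    (funext fun x => h0 x x.2)
    (fun t ht => by simpa using hC t ⟨ht.1, ht.2.le⟩)
  intro x hx t ht
  exact congrFun (hF0 t ht) ⟨x, hx⟩

/-! ### The pairing through `S` -/

variable {ι : Type*} [Fintype ι]

/-- The bilinear form `∑_{c, d} u_c S_{cd} v_d`. -/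
def pairing (S : Matrix ι ι ℝ) (u v : ι → ℂ) : ℂ :=
  ∑ c, ∑ d, u c * (S c d : ℂ) * v d

theorem pairing_comm {S : Matrix ι ι ℝ} (hS : S.IsSymm) (u v : ι → ℂ) :
    pairing S u v = pairing S v u := by
  unfold pairing
  rw [Finset.sum_comm]
  refine Finset.sum_congr rfl fun c _ => Finset.sum_congr rfl fun d _ => ?_
  rw [hS.apply]
  ring

theorem pairing_sub_left (S : Matrix ι ι ℝ) (u u' v : ι → ℂ) :
    pairing S (fun c => u c - u' c) v = pairing S u v - pairing S u' v := by
  simp only [pairing, sub_mul, Finset.sum_sub_distrib]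

theorem pairing_sub_right (S : Matrix ι ι ℝ) (u v v' : ι → ℂ) :
    pairing S u (fun d => v d - v' d) = pairing S u v - pairing S u v' := by
  simp only [pairing, mul_sub, Finset.sum_sub_distrib]

theorem pairing_smul_left (S : Matrix ι ι ℝ) (w : ℂ) (u v : ι → ℂ) :
    pairing S (fun c => w * u c) v = w * pairing S u v := by
  simp only [pairing, Finset.mul_sum, mul_assoc]

theorem pairing_sum_left {κ : Type*} (s : Finset κ) (S : Matrix ι ι ℝ) (u : κ → ι → ℂ)
    (v : ι → ℂ) : pairing S (fun c => ∑ b ∈ s, u b c) v = ∑ b ∈ s, pairing S (u b) v := by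
  simp only [pairing, Finset.sum_mul]
  rw [Finset.sum_comm, Finset.sum_congr rfl fun c _ => Finset.sum_comm, Finset.sum_comm]
  exact Finset.sum_congr rfl fun b _ => Finset.sum_comm

theorem isBigO_pairing_left {l : Filter ℝ} {g : ℝ → ℝ} (S : Matrix ι ι ℝ) {u v : ℝ → ι → ℂ}
    (hu : ∀ c, (fun t => u t c) =O[l] g) (hv : ∀ d, (fun t => v t d) =O[l] fun _ => (1 : ℝ)) :
    (fun t => pairing S (u t) (v t)) =O[l] g := by
  refine IsBigO.fun_sum fun c _ => IsBigO.fun_sum fun d _ => ?_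
  have := ((hu c).mul (isBigO_const_const (S c d : ℂ) (one_ne_zero (α := ℝ)) l)).mul (hv d)
  simpa using this

theorem isBigO_pairing_right {l : Filter ℝ} {g : ℝ → ℝ} (S : Matrix ι ι ℝ) {u v : ℝ → ι → ℂ}
    (hu : ∀ c, (fun t => u t c) =O[l] fun _ => (1 : ℝ)) (hv : ∀ d, (fun t => v t d) =O[l] g) :
    (fun t => pairing S (u t) (v t)) =O[l] g := by
  refine IsBigO.fun_sum fun c _ => IsBigO.fun_sum fun d _ => ?_
  have := ((hu c).mul (isBigO_const_const (S c d : ℂ) (one_ne_zero (α := ℝ)) l)).mul (hv d)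
  simpa using this

/-! ### The primitive equation in recursive form -/

theorem primitiveRHS_eq_pairing (S : Matrix ι ι ℝ) (K : List Charge → List ι → ℂ)
    (σ : List Charge) (a : List ι) :
    primitiveRHS S K σ a = ∑ j ∈ Finset.range a.length, ∑ i ∈ Finset.range j,
      pairing S (fun c => K (cutLeftCharges (i + 1) (j + 1) σ)
          (cutLeftVertices (i + 1) (j + 1) c a))
        (fun d => K (cutRightCharges (i + 1) (j + 1) σ)
          (cutRightVertices (i + 1) (j + 1) d a)) := by
  have h (f : ℕ → ℂ) (l : ℕ) : ∑ k ∈ Finset.Ico 1 (l + 1), f k =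
      ∑ i ∈ Finset.range l, f (i + 1) := by
    rw [Finset.range_eq_Ico, Finset.sum_Ico_add' f 0 l 1]
  unfold primitiveRHS
  rw [show Finset.Icc 1 a.length = Finset.Ico 1 (a.length + 1) from rfl, h]
  exact Finset.sum_congr rfl fun j _ => h _ _

/-- The cuts of a loop with a distinguished first entry: either the first entry is cut (`i = 0`),
or the cut takes place in the rest of the loop. -/
theorem primitiveRHS_cons (S : Matrix ι ι ℝ) (K : List Charge → List ι → ℂ)
    (s : Charge) (x : ι) (σ : List Charge) (a : List ι) :
    primitiveRHS S K (s :: σ) (x :: a) = ∑ j ∈ Finset.range a.length,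
      (pairing S (fun c => K (s :: σ.drop j) (c :: a.drop j))
          (fun d => K (s :: σ.take (j + 1)) (x :: (a.take j ++ [d]))) +
        ∑ i ∈ Finset.range j,
          pairing S (fun c => K (s :: cutLeftCharges (i + 1) (j + 1) σ)
              (x :: cutLeftVertices (i + 1) (j + 1) c a))
            (fun d => K (cutRightCharges (i + 1) (j + 1) σ)
              (cutRightVertices (i + 1) (j + 1) d a))) := by
  rw [primitiveRHS_eq_pairing, List.length_cons, Finset.sum_range_succ', Finset.sum_range_zero,
    add_zero]
  refine Finset.sum_congr rfl fun j _ => ?_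
  rw [Finset.sum_range_succ', add_comm]
  congr 1
  · simp [cutLeftCharges, cutLeftVertices, cutRightCharges, cutRightVertices]

theorem cutLeftCharges_append {i j : ℕ} {σ : List Charge} (hij : i < j) (hj : j < σ.length)
    (s : Charge) : cutLeftCharges (i + 1) (j + 1) (σ ++ [s]) =
      cutLeftCharges (i + 1) (j + 1) σ ++ [s] := by
  simp only [cutLeftCharges, Nat.add_sub_cancel]
  rw [List.take_append_of_le_length (by omega), List.drop_append_of_le_length (by omega),
    List.append_assoc]

theorem cutLeftVertices_append {α : Type*} {i j : ℕ} {a : List α} (hij : i < j) (hj : j < a.length)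
    (c x : α) : cutLeftVertices (i + 1) (j + 1) c (a ++ [x]) =
      cutLeftVertices (i + 1) (j + 1) c a ++ [x] := by
  simp only [cutLeftVertices, Nat.add_sub_cancel]
  rw [List.take_append_of_le_length (by omega), List.drop_append_of_le_length (by omega),
    List.append_assoc]
  simp

theorem cutRightCharges_append {i j : ℕ} {σ : List Charge} (hij : i < j) (hj : j < σ.length)
    (s : Charge) : cutRightCharges (i + 1) (j + 1) (σ ++ [s]) =
      cutRightCharges (i + 1) (j + 1) σ := by
  simp only [cutRightCharges, Nat.add_sub_cancel]
  rw [List.drop_append_of_le_length (by omega),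
    List.take_append_of_le_length (by rw [List.length_drop]; omega)]

theorem cutRightVertices_append {α : Type*} {i j : ℕ} {a : List α} (hij : i < j) (hj : j < a.length)
    (d x : α) : cutRightVertices (i + 1) (j + 1) d (a ++ [x]) =
      cutRightVertices (i + 1) (j + 1) d a := by
  simp only [cutRightVertices, Nat.add_sub_cancel]
  rw [List.drop_append_of_le_length (by omega),
    List.take_append_of_le_length (by rw [List.length_drop]; omega)]

theorem cutLeftCharges_append_last {i : ℕ} {σ : List Charge} (hi : i < σ.length) (s : Charge) :
    cutLeftCharges (i + 1) (σ.length + 1) (σ ++ [s]) = σ.take (i + 1) ++ [s] := by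
  simp only [cutLeftCharges, Nat.add_sub_cancel]
  rw [List.take_append_of_le_length (by omega), List.drop_left]

theorem cutLeftVertices_append_last {α : Type*} {i : ℕ} {a : List α} (hi : i < a.length)
    (c x : α) : cutLeftVertices (i + 1) (a.length + 1) c (a ++ [x]) = a.take i ++ [c] ++ [x] := by
  simp only [cutLeftVertices, Nat.add_sub_cancel]
  rw [List.take_append_of_le_length (by omega), List.drop_left]

theorem cutRightCharges_append_last {i : ℕ} {σ : List Charge} (hi : i < σ.length) (s : Charge) :
    cutRightCharges (i + 1) (σ.length + 1) (σ ++ [s]) = σ.drop i ++ [s] := by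
  simp only [cutRightCharges, Nat.add_sub_cancel]
  rw [List.drop_append_of_le_length (by omega), List.take_of_length_le (by simp)]

theorem cutRightVertices_append_last {α : Type*} {i : ℕ} {a : List α} (hi : i < a.length)
    (d x : α) : cutRightVertices (i + 1) (a.length + 1) d (a ++ [x]) = a.drop i ++ [d] := by
  simp only [cutRightVertices, Nat.add_sub_cancel]
  rw [List.drop_append_of_le_length (by omega), List.take_append_of_le_length (by simp),
    List.take_of_length_le (by simp)]

/-- The cuts of a loop with a distinguished last entry: either the last entry is cut, or the cut
takes place in the rest of the loop. -/
theorem primitiveRHS_append (S : Matrix ι ι ℝ) (K : List Charge → List ι → ℂ)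
    (s : Charge) (x : ι) {σ : List Charge} {a : List ι} (h : σ.length = a.length) :
    primitiveRHS S K (σ ++ [s]) (a ++ [x]) = ∑ j ∈ Finset.range a.length,
      (pairing S (fun c => K (σ.take (j + 1) ++ [s]) (a.take j ++ [c] ++ [x]))
          (fun d => K (σ.drop j ++ [s]) (a.drop j ++ [d])) +
        ∑ i ∈ Finset.range j,
          pairing S (fun c => K (cutLeftCharges (i + 1) (j + 1) σ ++ [s])
              (cutLeftVertices (i + 1) (j + 1) c a ++ [x]))
            (fun d => K (cutRightCharges (i + 1) (j + 1) σ)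
              (cutRightVertices (i + 1) (j + 1) d a))) := by
  rw [primitiveRHS_eq_pairing, List.length_append, List.length_singleton, Finset.sum_range_succ,
    Finset.sum_add_distrib, add_comm]
  congr 1
  · refine Finset.sum_congr rfl fun i hi => ?_
    rw [Finset.mem_range] at hi
    simp only [cutLeftVertices_append_last hi, cutRightVertices_append_last hi]
    rw [← h] at hi ⊢
    simp only [cutLeftCharges_append_last hi, cutRightCharges_append_last hi]
  · refine Finset.sum_congr rfl fun j hj => Finset.sum_congr rfl fun i hi => ?_
    rw [Finset.mem_range] at hi hj
    simp only [cutLeftCharges_append hi (h ▸ hj), cutRightCharges_append hi (h ▸ hj),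
      cutLeftVertices_append hi hj, cutRightVertices_append hi hj]

/-- The cuts of a loop with distinguished first and last entries. The cuts at `(0, j)` and at
`(j + 1, last)` are collected under the same `j`; the last summand is the cut at `(0, last)`. -/
theorem primitiveRHS_cons_append (S : Matrix ι ι ℝ) (K : List Charge → List ι → ℂ)
    (s s' : Charge) (x y : ι) {σ : List Charge} {a : List ι} (h : σ.length = a.length) :
    primitiveRHS S K (s :: σ ++ [s']) (x :: a ++ [y]) =
      (∑ j ∈ Finset.range a.length,
        (pairing S (fun c => K (s :: σ.drop j ++ [s']) (c :: a.drop j ++ [y]))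
            (fun d => K (s :: σ.take (j + 1)) (x :: (a.take j ++ [d]))) +
          pairing S (fun c => K (s :: σ.take (j + 1) ++ [s']) (x :: (a.take j ++ [c]) ++ [y]))
            (fun d => K (σ.drop j ++ [s']) (a.drop j ++ [d])) +
          ∑ i ∈ Finset.range j,
            pairing S (fun c => K (s :: cutLeftCharges (i + 1) (j + 1) σ ++ [s'])
                (x :: cutLeftVertices (i + 1) (j + 1) c a ++ [y]))
              (fun d => K (cutRightCharges (i + 1) (j + 1) σ)
                (cutRightVertices (i + 1) (j + 1) d a)))) +
        pairing S (fun c => K ([s] ++ [s']) ([c] ++ [y]))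
          (fun d => K (s :: σ ++ [s']) (x :: a ++ [d])) := by
  rw [List.cons_append, List.cons_append, primitiveRHS_cons, List.length_append,
    List.length_singleton, Finset.sum_range_succ, add_comm (pairing _ _ _) (Finset.sum _ _),
    ← add_assoc, ← Finset.sum_add_distrib]
  congr 1
  · refine Finset.sum_congr rfl fun j hj => ?_
    rw [Finset.mem_range] at hj
    rw [add_right_comm]
    congr 1
    · congr 1
      · rw [List.drop_append_of_le_length (by omega), List.drop_append_of_le_length (by omega),
          List.take_append_of_le_length (by omega), List.take_append_of_le_length (by omega)]
        rfl
      · simp only [cutLeftVertices_append_last hj, cutRightVertices_append_last hj]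
        rw [← h] at hj ⊢
        simp only [cutLeftCharges_append_last hj, cutRightCharges_append_last hj]
        rfl
    · refine Finset.sum_congr rfl fun i hi => ?_
      rw [Finset.mem_range] at hi
      simp only [cutLeftCharges_append hi (h ▸ hj), cutRightCharges_append hi (h ▸ hj),
        cutLeftVertices_append hi hj, cutRightVertices_append hi hj]
      rfl
  · rw [List.drop_left, List.take_left, ← h, List.drop_left,
      List.take_of_length_le (by simp)]
    rfl

/-- A cut of a loop of length at least two produces loops of length at least two only. -/
theorem primitiveRHS_congr (S : Matrix ι ι ℝ) {K K' : List Charge → List ι → ℂ}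
    (h : ∀ σ a, 2 ≤ a.length → K σ a = K' σ a) (σ : List Charge) (a : List ι) :
    primitiveRHS S K σ a = primitiveRHS S K' σ a := by
  rw [primitiveRHS_eq_pairing, primitiveRHS_eq_pairing]
  refine Finset.sum_congr rfl fun j hj => Finset.sum_congr rfl fun i hi => ?_
  rw [Finset.mem_range] at hi hj
  congr 1 <;> funext c <;> apply h
  · simp [cutLeftVertices]; omega
  · simp [cutRightVertices]; omega

instance : Finite Charge :=
  Finite.of_surjective (fun b : Bool => if b then Charge.plus else Charge.minus) fun
    | .plus => ⟨true, rfl⟩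
    | .minus => ⟨false, rfl⟩

/-- Loops of a bounded length form a finite index set. -/
theorem finite_loops (m n : ℕ) :
    {p : List Charge × List ι | p.1.length ≤ m ∧ p.2.length ≤ n}.Finite :=
  (List.finite_length_le Charge m).prod (List.finite_length_le ι n)

variable [DecidableEq ι]

/-! ### Loops of every length -/

/-- The primitive equations and their initial condition for loops of every length, including
lengths zero and one, which `IsPrimitiveLoops` leaves out. At these lengths `primitiveRHS` is an
empty sum. -/
structure IsLoopFamily (I : Set ℝ) (S : Matrix ι ι ℝ) (M : Matrix ι ι ℂ)
    (K : ℝ → List Charge → List ι → ℂ) : Prop where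
  initial : ∀ (σ : List Charge) (a : List ι), σ.length = a.length → K 0 σ a = mLoop M σ a
  primitive : ∀ (σ : List Charge) (a : List ι), σ.length = a.length →
    ∀ t ∈ I, HasDerivWithinAt (fun s => K s σ a) (primitiveRHS S (K t) σ a) I t

/-- The loops of length less than two have no cuts, so constants solve their equations, and they
do not occur in the equations for the longer loops. -/
theorem IsPrimitiveLoops.isLoopFamily {I : Set ℝ} {S : Matrix ι ι ℝ} {M : Matrix ι ι ℂ}
    {K : ℝ → List Charge → List ι → ℂ} (hK : IsPrimitiveLoops I S M K) :
    IsLoopFamily I S M fun t σ a => if 2 ≤ a.length then K t σ a else mLoop M σ a where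
  initial σ a h := by
    split_ifs with ha
    exacts [hK.initial σ a ha h, rfl]
  primitive σ a h t ht := by
    by_cases ha : 2 ≤ a.length
    · simp only [ha, if_true]
      rw [primitiveRHS_congr S (K' := K t) (fun σ a ha => if_pos ha)]
      exact hK.primitive σ a ha h t ht
    · simp only [ha, if_false]
      have h0 : primitiveRHS S (fun σ a => if 2 ≤ a.length then K t σ a else mLoop M σ a) σ a
          = 0 := by
        rw [primitiveRHS_eq_pairing]
        refine Finset.sum_eq_zero fun j hj => ?_
        rw [Finset.mem_range] at hj
        rw [show j = 0 by omega, Finset.sum_range_zero]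
      rw [h0]
      exact hasDerivWithinAt_const ..

section
variable {I : Set ℝ} {S : Matrix ι ι ℝ} {M : Matrix ι ι ℂ} {K : ℝ → List Charge → List ι → ℂ}

theorem IsLoopFamily.mono (hK : IsLoopFamily I S M K) {J : Set ℝ} (hJ : J ⊆ I) :
    IsLoopFamily J S M K :=
  ⟨hK.initial, fun σ a h t ht => (hK.primitive σ a h t (hJ ht)).mono hJ⟩

theorem IsLoopFamily.isBigO_one (hK : IsLoopFamily I S M K) (hI : IsCompact I)
    {σ : List Charge} {a : List ι} (h : σ.length = a.length) :
    (fun t => K t σ a) =O[𝓟 I] fun _ => (1 : ℝ) :=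
  ContinuousOn.isBigO_principal (fun t ht => (hK.primitive σ a h t ht).continuousWithinAt) hI
    (by norm_num)

end

theorem mLoop_cons (M : Matrix ι ι ℂ) (s : Charge) (σ : List Charge) (x : ι) (a : List ι) :
    mLoop M (s :: σ) (x :: a) = (chargedMatrix M s * siteMatrix x *
      (List.zipWith (fun s x => chargedMatrix M s * siteMatrix x) σ a).prod).trace := by
  simp [mLoop]

theorem mLoop_append (M : Matrix ι ι ℂ) (s : Charge) {σ : List Charge} (x : ι) {a : List ι}
    (h : σ.length = a.length) :
    mLoop M (σ ++ [s]) (a ++ [x]) =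
      ((List.zipWith (fun s x => chargedMatrix M s * siteMatrix x) σ a).prod *
        (chargedMatrix M s * siteMatrix x)).trace := by
  simp [mLoop, List.zipWith_append h]

/-! ### Cyclic invariance -/

/-- Primitive loops are invariant under cyclic rotation. -/
theorem IsLoopFamily.rotate {T : ℝ} {S : Matrix ι ι ℝ} {M : Matrix ι ι ℂ}
    {K : ℝ → List Charge → List ι → ℂ} (hK : IsLoopFamily (Set.Icc 0 T) S M K) (hS : S.IsSymm)
    {t : ℝ} (ht : t ∈ Set.Icc 0 T) (s : Charge) (x : ι) {σ : List Charge} {a : List ι}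
    (h : σ.length = a.length) :
    K t (s :: σ) (x :: a) = K t (σ ++ [s]) (a ++ [x]) := by
  obtain ⟨N, hN⟩ : ∃ N, a.length + 1 ≤ N := ⟨_, le_rfl⟩
  let P : Set (List Charge × List ι) := {p | p.1.length = p.2.length ∧ p.2.length ≤ N}
  have hP : P.Finite := (finite_loops N N).subset
    fun p hp => ⟨hp.1.trans_le hp.2, hp.2⟩
  have key := eq_zero_of_deriv_isBigO (T := T) hP
    (f := fun p t => K t p.1 p.2 - K t (p.1.rotate 1) (p.2.rotate 1))
    (f' := fun p t => primitiveRHS S (K t) p.1 p.2 -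
      primitiveRHS S (K t) (p.1.rotate 1) (p.2.rotate 1))
    (fun p hp t ht => (hK.primitive _ _ hp.1 t ht).sub
      (hK.primitive _ _ (by simpa using hp.1) t ht)) ?_ ?_ (s :: σ, x :: a)
    ⟨by simpa using h, by simpa using hN⟩ t ht
  · simpa [sub_eq_zero] using key
  · rintro ⟨σ, a⟩ ⟨h, -⟩
    match σ, a, h with
    | [], [], _ => simp
    | s :: σ, x :: a, h =>
      have h : σ.length = a.length := by simpa using h
      simp only [List.rotate_cons_succ, List.rotate_zero]
      rw [hK.initial _ _ (by simpa using h), hK.initial _ _ (by simpa using h), mLoop_cons,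
        mLoop_append M s x h, Matrix.trace_mul_comm, sub_self]
  · rintro g hg ⟨σ, a⟩ ⟨h, hl⟩
    match σ, a, h, hl with
    | [], [], _, _ => simpa using isBigO_zero g _
    | s :: σ, x :: a, h, hl =>
      replace h : σ.length = a.length := by simpa using h
      simp only [List.length_cons] at hl
      have hE (s : Charge) (x : ι) (σ : List Charge) (a : List ι) (h : σ.length = a.length)
          (hl : (x :: a).length ≤ N) :
          (fun t => K t (s :: σ) (x :: a) - K t (σ ++ [s]) (a ++ [x])) =O[𝓟 (Set.Icc 0 T)] g := by
        simpa using hg (s :: σ, x :: a) ⟨by simpa using h, hl⟩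
      have hB {σ : List Charge} {a : List ι} (h : σ.length = a.length) :=
        hK.isBigO_one isCompact_Icc h
      -- The cut at `(0, j + 1)` gives a product `u v`, its rotation gives `v' u'`, and
      -- `u v - u' v' = (u - u') v + u' (v - v')`.
      have eq (t : ℝ) : primitiveRHS S (K t) (s :: σ) (x :: a) -
          primitiveRHS S (K t) (σ ++ [s]) (a ++ [x]) =
          ∑ j ∈ Finset.range a.length,
            (pairing S (fun c => K t (s :: σ.drop j) (c :: a.drop j) -
                  K t (σ.drop j ++ [s]) (a.drop j ++ [c]))
                (fun d => K t (s :: σ.take (j + 1)) (x :: (a.take j ++ [d]))) +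
              pairing S (fun c => K t (σ.drop j ++ [s]) (a.drop j ++ [c]))
                (fun d => K t (s :: σ.take (j + 1)) (x :: (a.take j ++ [d])) -
                  K t (σ.take (j + 1) ++ [s]) (a.take j ++ [d] ++ [x])) +
              ∑ i ∈ Finset.range j,
                pairing S (fun c => K t (s :: cutLeftCharges (i + 1) (j + 1) σ)
                    (x :: cutLeftVertices (i + 1) (j + 1) c a) -
                    K t (cutLeftCharges (i + 1) (j + 1) σ ++ [s])
                    (cutLeftVertices (i + 1) (j + 1) c a ++ [x]))
                  (fun d => K t (cutRightCharges (i + 1) (j + 1) σ)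
                    (cutRightVertices (i + 1) (j + 1) d a))) := by
        rw [primitiveRHS_cons, primitiveRHS_append S _ s x h, ← Finset.sum_sub_distrib]
        refine Finset.sum_congr rfl fun j _ => ?_
        simp only [pairing_sub_left, pairing_sub_right, Finset.sum_sub_distrib]
        rw [pairing_comm hS (fun c => K t (σ.take (j + 1) ++ [s]) (a.take j ++ [c] ++ [x]))]
        ring
      simp only [List.rotate_cons_succ, List.rotate_zero, eq]
      refine IsBigO.fun_sum fun j hj => ((isBigO_pairing_left S ?_ ?_).add
        (isBigO_pairing_right S ?_ ?_)).add (IsBigO.fun_sum fun i hi =>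
          isBigO_pairing_left S ?_ ?_) <;> rw [Finset.mem_range] at hj
      · exact fun c => hE _ _ _ _ (by simp [h]) (by simp; omega)
      · exact fun d => hB (by simp; omega)
      · exact fun c => hB (by simp [h])
      · exact fun d => hE _ _ _ _ (by simp; omega) (by simp; omega)
      · rw [Finset.mem_range] at hi
        exact fun c => hE _ _ _ _ (by simp [cutLeftCharges, cutLeftVertices]; omega)
          (by simp [cutLeftVertices]; omega)
      · rw [Finset.mem_range] at hi
        exact fun d => hB (by simp [cutRightCharges, cutRightVertices]; omega)

/-! ### The spectral parameter -/

/-- The resolvent identity for `M = (Λ - z_0)⁻¹` and its adjoint. -/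
theorem GeneralAssumption.sub_conjTranspose {I : Set ℝ} {Λ : Matrix ι ι ℂ} {S : Matrix ι ι ℝ}
    {z : ℝ → ℂ} {M : Matrix ι ι ℂ} (hM : GeneralAssumption I Λ S z M) (h0 : (0 : ℝ) ∈ I) :
    M - M.conjTranspose = (z 0 - starRingEnd ℂ (z 0)) • (M.conjTranspose * M) := by
  set A : Matrix ι ι ℂ := Λ - z 0 • 1 with hA
  have hMA : M * A = 1 := by simpa [hA] using hM.equation 0 h0
  have hAM : M.conjTranspose * A.conjTranspose = 1 := by
    rw [← Matrix.conjTranspose_mul, mul_eq_one_comm.1 hMA, Matrix.conjTranspose_one]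
  have hAA : A.conjTranspose - A = (z 0 - starRingEnd ℂ (z 0)) • (1 : Matrix ι ι ℂ) := by
    rw [hA, Matrix.conjTranspose_sub, hM.hermitian.eq, Matrix.conjTranspose_smul,
      Matrix.conjTranspose_one, sub_smul]
    simp
  calc M - M.conjTranspose
      = M.conjTranspose * A.conjTranspose * M - M.conjTranspose * (A * M) := by
        rw [hAM, mul_eq_one_comm.1 hMA, one_mul, mul_one]
    _ = M.conjTranspose * (A.conjTranspose - A) * M := by
        noncomm_ring
    _ = _ := by rw [hAA]; simp

theorem GeneralAssumption.parameter_eq {I : Set ℝ} {Λ : Matrix ι ι ℂ} {S : Matrix ι ι ℝ}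
    {z : ℝ → ℂ} {M : Matrix ι ι ℂ} (hM : GeneralAssumption I Λ S z M) (h0 : (0 : ℝ) ∈ I)
    {t : ℝ} (ht : t ∈ I) (i : ι) : z t = z 0 - t * ∑ j, (S i j : ℂ) * M j j := by
  have h1 := mul_eq_one_comm.1 (hM.equation 0 h0)
  have h := left_inv_eq_right_inv h1 (hM.equation t ht)
  have := congrFun (congrFun h i) i
  simp [selfEnergy] at this
  linear_combination this

/-- At a time `T ≠ 0`, `2iη_T = 2iη_0 - T κ`, where `κ` is the common value of the
components of `S (M - M*)`. -/
theorem GeneralAssumption.exists_slope {I : Set ℝ} {Λ : Matrix ι ι ℂ} {S : Matrix ι ι ℝ}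
    {z : ℝ → ℂ} {M : Matrix ι ι ℂ} (hM : GeneralAssumption I Λ S z M) (h0 : (0 : ℝ) ∈ I)
    {T : ℝ} (hT : T ∈ I) (hT0 : T ≠ 0) :
    ∃ κ : ℂ, (∀ d, ∑ c, (S d c : ℂ) * (M c c - starRingEnd ℂ (M c c)) = κ) ∧
      z T - starRingEnd ℂ (z T) = z 0 - starRingEnd ℂ (z 0) - T * κ := by
  have hT' : (T : ℂ) ≠ 0 := by exact_mod_cast hT0
  have h (d : ι) : T * ∑ c, (S d c : ℂ) * (M c c - starRingEnd ℂ (M c c)) =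
      z 0 - starRingEnd ℂ (z 0) - (z T - starRingEnd ℂ (z T)) := by
    rw [hM.parameter_eq h0 hT d]
    simp only [map_sub, map_mul, map_sum, Complex.conj_ofReal, mul_sub, Finset.sum_sub_distrib]
    ring
  refine ⟨(z 0 - starRingEnd ℂ (z 0) - (z T - starRingEnd ℂ (z T))) / T, fun d => ?_, ?_⟩
  · rw [← h d, mul_div_cancel_left₀ _ hT']
  · rw [mul_div_cancel₀ _ hT']
    ring

/-! ### Ward's identity -/

theorem mLoop_singleton (M : Matrix ι ι ℂ) (s : Charge) (x : ι) :
    mLoop M [s] [x] = chargedMatrix M s x x := by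
  simp [mLoop, siteMatrix, Matrix.trace_mul_single]

/-- Ward's identity for `M`-loops; `hl` admits loops of length one. -/
theorem mLoop_ward {M : Matrix ι ι ℂ} {w : ℂ}
    (h : M - M.conjTranspose = w • (M.conjTranspose * M)) {σ : List Charge} {a : List ι}
    (hl : a.length = σ.length + 1) :
    mLoop M (Charge.plus :: σ) a - mLoop M (Charge.minus :: σ) a =
      w * ∑ b, mLoop M (Charge.plus :: σ ++ [Charge.minus]) (a ++ [b]) := by
  have hF : ∑ b : ι, siteMatrix b = (1 : Matrix ι ι ℂ) := by
    simp [siteMatrix, Matrix.sum_single_one]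
  rw [Finset.sum_congr rfl fun b _ => mLoop_append M _ b (by simpa using hl.symm),
    ← Matrix.trace_sum, ← Finset.mul_sum, ← Finset.mul_sum, hF, mul_one]
  obtain ⟨x, a, rfl⟩ := List.exists_cons_of_length_eq_add_one hl
  rw [mLoop_cons, mLoop_cons, ← Matrix.trace_sub, ← sub_mul, ← sub_mul, Matrix.trace_mul_comm _
    (chargedMatrix M Charge.minus)]
  simp only [chargedMatrix, h, List.zipWith_cons_cons, List.prod_cons]
  simp [mul_assoc]

/-- Ward's identity for loop families of every length, with the affine function `w - t κ` in place
of `2iη_t`. The hypothesis `hκ` is on the loops of length one. -/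
theorem IsLoopFamily.ward {T : ℝ} {S : Matrix ι ι ℝ} {M : Matrix ι ι ℂ}
    {K : ℝ → List Charge → List ι → ℂ} (hK : IsLoopFamily (Set.Icc 0 T) S M K) (hS : S.IsSymm)
    {w κ : ℂ} (hw : M - M.conjTranspose = w • (M.conjTranspose * M))
    (hκ : ∀ t d, ∑ c, (S d c : ℂ) * (K t [Charge.plus] [c] - K t [Charge.minus] [c]) = κ)
    {t : ℝ} (ht : t ∈ Set.Icc 0 T) {σ : List Charge} {a : List ι} (h : a.length = σ.length + 1) :
    K t (Charge.plus :: σ) a - K t (Charge.minus :: σ) a =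
      (w - t * κ) * ∑ b, K t (Charge.plus :: σ ++ [Charge.minus]) (a ++ [b]) := by
  obtain ⟨N, hN⟩ : ∃ N, a.length ≤ N := ⟨_, le_rfl⟩
  let P : Set (List Charge × List ι) := {p | p.2.length = p.1.length + 1 ∧ p.2.length ≤ N}
  have hP : P.Finite := (finite_loops N N).subset
    fun p hp => ⟨(Nat.le_succ _).trans (hp.1.symm.trans_le hp.2), hp.2⟩
  let E : ℝ → List Charge → List ι → ℂ := fun t σ a =>
    K t (Charge.plus :: σ) a - K t (Charge.minus :: σ) a -
      (w - t * κ) * ∑ b, K t (Charge.plus :: σ ++ [Charge.minus]) (a ++ [b])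
  let E' : ℝ → List Charge → List ι → ℂ := fun t σ a =>
    primitiveRHS S (K t) (Charge.plus :: σ) a - primitiveRHS S (K t) (Charge.minus :: σ) a -
      ((-κ) * (∑ b, K t (Charge.plus :: σ ++ [Charge.minus]) (a ++ [b])) +
        (w - t * κ) *
          ∑ b, primitiveRHS S (K t) (Charge.plus :: σ ++ [Charge.minus]) (a ++ [b]))
  have hwt (t : ℝ) : HasDerivWithinAt (fun t : ℝ => w - t * κ) (-κ) (Set.Icc 0 T) t := by
    have := ((Complex.ofRealCLM.hasDerivWithinAt (s := Set.Icc 0 T) (x := t)).mul_const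
      κ).const_sub w
    simpa using this
  have key := eq_zero_of_deriv_isBigO (T := T) hP (f := fun p t => E t p.1 p.2)
    (f' := fun p t => E' t p.1 p.2)
    (fun p hp t ht => ((hK.primitive _ _ (by simpa using hp.1.symm) t ht).sub
      (hK.primitive _ _ (by simpa using hp.1.symm) t ht)).sub
        ((hwt t).mul (HasDerivWithinAt.fun_sum fun b _ =>
          hK.primitive _ _ (by simpa using hp.1.symm) t ht))) ?_ ?_ (σ, a) ⟨h, hN⟩ t ht
  · exact sub_eq_zero.1 key
  · rintro ⟨σ, a⟩ ⟨h, -⟩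
    simp only [E]
    rw [hK.initial _ _ (by simpa using h.symm), hK.initial _ _ (by simpa using h.symm),
      Finset.sum_congr rfl fun b _ => hK.initial _ _ (by simpa using h.symm), mLoop_ward hw h]
    simp
  · rintro g hg ⟨σ, a⟩ ⟨h, hl⟩
    obtain ⟨x, a, rfl⟩ := List.exists_cons_of_length_eq_add_one h
    replace h : σ.length = a.length := by simpa using h.symm
    simp only [List.length_cons] at hl
    have hE {σ : List Charge} {a : List ι} (h : a.length = σ.length + 1) (hl : a.length ≤ N) :
        (fun t => E t σ a) =O[𝓟 (Set.Icc 0 T)] g := hg (σ, a) ⟨h, hl⟩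
    have hB {σ : List Charge} {a : List ι} (h : σ.length = a.length) :=
      hK.isBigO_one isCompact_Icc h
    -- The derivative of the defect is a combination of defects of loops that are not longer.
    have eq (t : ℝ) (ht : t ∈ Set.Icc 0 T) : E' t σ (x :: a) =
        (∑ j ∈ Finset.range a.length,
          (pairing S (fun c => E t (σ.drop j) (c :: a.drop j))
              (fun d => K t (Charge.plus :: σ.take (j + 1)) (x :: (a.take j ++ [d]))) +
            pairing S (fun c => E t (σ.take (j + 1)) (x :: (a.take j ++ [c])))
              (fun d => K t (σ.drop j ++ [Charge.minus]) (a.drop j ++ [d])) +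
            ∑ i ∈ Finset.range j,
              pairing S (fun c => E t (cutLeftCharges (i + 1) (j + 1) σ)
                  (x :: cutLeftVertices (i + 1) (j + 1) c a))
                (fun d => K t (cutRightCharges (i + 1) (j + 1) σ)
                  (cutRightVertices (i + 1) (j + 1) d a)))) +
          pairing S (fun c => E t [] [c])
            (fun d => K t (Charge.plus :: σ ++ [Charge.minus]) (x :: a ++ [d])) := by
      have hcyc (j : ℕ) (d : ι) : K t (Charge.minus :: σ.drop j) (d :: a.drop j) =
          K t (σ.drop j ++ [Charge.minus]) (a.drop j ++ [d]) :=
        hK.rotate hS ht _ _ (by simp [h])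
      have hlast (d : ι) :
          ∑ c, (K t [Charge.plus] [c] - K t [Charge.minus] [c]) * (S c d : ℂ) = κ := by
        rw [← hκ t d]
        refine Finset.sum_congr rfl fun c _ => ?_
        rw [hS.apply, mul_comm]
      -- The length-one Ward sum turns into the derivative of `w - t κ`.
      have hpair : pairing S (fun c => K t [Charge.plus] [c] - K t [Charge.minus] [c])
          (fun d => K t (Charge.plus :: σ ++ [Charge.minus]) (x :: a ++ [d])) =
          κ * ∑ d, K t (Charge.plus :: σ ++ [Charge.minus]) (x :: a ++ [d]) := by
        rw [pairing, Finset.sum_comm, Finset.mul_sum]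
        refine Finset.sum_congr rfl fun d _ => ?_
        rw [← Finset.sum_mul, hlast]
      have hEp (σ : List Charge) (a : ι → List ι) (v : ι → ℂ) :
          pairing S (fun c => E t σ (a c)) v =
            pairing S (fun c => K t (Charge.plus :: σ) (a c)) v -
            pairing S (fun c => K t (Charge.minus :: σ) (a c)) v -
            (w - t * κ) * ∑ b, pairing S (fun c =>
              K t (Charge.plus :: σ ++ [Charge.minus]) (a c ++ [b])) v := by
        simp only [E, pairing_sub_left, pairing_smul_left, pairing_sum_left]
      simp only [E']
      rw [primitiveRHS_cons, primitiveRHS_cons,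
        Finset.sum_congr rfl fun b _ => primitiveRHS_cons_append S (K t) _ _ x b h]
      have hsum (A B : ι → ℕ → ℂ) (C : ι → ℕ → ℕ → ℂ) (D : ι → ℂ) :
          ∑ b, (∑ j ∈ Finset.range a.length, (A b j + B b j + ∑ i ∈ Finset.range j, C b j i) +
            D b) = ∑ j ∈ Finset.range a.length, (∑ b, A b j + ∑ b, B b j +
              ∑ i ∈ Finset.range j, ∑ b, C b j i) + ∑ b, D b := by
        rw [Finset.sum_add_distrib, Finset.sum_comm]
        congr 1
        refine Finset.sum_congr rfl fun j _ => ?_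
        rw [Finset.sum_add_distrib, Finset.sum_add_distrib, Finset.sum_comm (s := Finset.univ)]
      have hadd (A B C : ℕ → ℂ) (p q u v : ℂ) : ∑ j ∈ Finset.range a.length, A j -
          ∑ j ∈ Finset.range a.length, B j - (-p * q +
            u * (∑ j ∈ Finset.range a.length, C j + v)) =
          ∑ j ∈ Finset.range a.length, (A j - B j - u * C j) + (p * q - u * v) := by
        rw [Finset.sum_sub_distrib, Finset.sum_sub_distrib, ← Finset.mul_sum]
        ring
      rw [hsum, hadd]
      congr 1
      · refine Finset.sum_congr rfl fun j _ => ?_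
        simp only [hEp, hcyc, Finset.sum_sub_distrib, ← Finset.mul_sum]
        rw [pairing_comm hS (fun c => K t (Charge.plus :: σ.take (j + 1)) _),
          pairing_comm hS (fun c => K t (Charge.minus :: σ.take (j + 1)) _)]
        ring
      · rw [hEp, ← pairing_sub_left, hpair]
    refine IsBigO.congr' (f₁ := fun t => _) (g₁ := g) ?_
      (eventually_principal.2 fun t ht => (eq t ht).symm) (EventuallyEq.refl _ _)
    refine (IsBigO.fun_sum fun j hj => ((isBigO_pairing_left S ?_ ?_).add
      (isBigO_pairing_left S ?_ ?_)).add (IsBigO.fun_sum fun i hi =>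
        isBigO_pairing_left S ?_ ?_)).add (isBigO_pairing_left S ?_ ?_)
    case refine_7 => exact fun c => hE rfl (by simp; omega)
    case refine_8 => exact fun d => hB (by simp [h])
    all_goals rw [Finset.mem_range] at hj
    · exact fun c => hE (by simp [h]) (by simp; omega)
    · exact fun d => hB (by simp; omega)
    · exact fun d => hE (by simp; omega) (by simp; omega)
    · exact fun c => hB (by simp [h])
    · rw [Finset.mem_range] at hi
      exact fun c => hE (by simp [cutLeftCharges, cutLeftVertices]; omega)
        (by simp [cutLeftVertices]; omega)
    · rw [Finset.mem_range] at hi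
      exact fun d => hB (by simp [cutRightCharges, cutRightVertices]; omega)

end PrimitiveLoop

theorem corollary4p3 {ι : Type*} [Fintype ι] [DecidableEq ι]
    (I : Set ℝ) (hI : I.OrdConnected) (hI0 : (0 : ℝ) ∈ I) (hIpos : ∀ t ∈ I, 0 ≤ t)
    (Λ : Matrix ι ι ℂ) (S : Matrix ι ι ℝ) (z : ℝ → ℂ) (M : Matrix ι ι ℂ)
    (hM : PrimitiveLoop.GeneralAssumption I Λ S z M)
    (K : ℝ → List Charge → List ι → ℂ)
    (hK : PrimitiveLoop.IsPrimitiveLoops I S M K)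
    (t : ℝ) (ht : t ∈ I)
    (n : ℕ) (hn : 2 ≤ n)
    (σ : List Charge) (hσ : σ.length = n - 1)
    (a : List ι) (ha : a.length = n) :
    (K t (Charge.plus :: σ) a - K t (Charge.minus :: σ) a) / (2 * Complex.I * ((z t).im : ℂ)) =
      ∑ b : ι, K t (Charge.plus :: σ ++ [Charge.minus]) (a ++ [b]) := by
  have hz : 2 * Complex.I * ((z t).im : ℂ) = z t - starRingEnd ℂ (z t) := by
    rw [Complex.sub_conj]
    push_cast
    ring
  have hne : 2 * Complex.I * ((z t).im : ℂ) ≠ 0 :=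
    mul_ne_zero (by simp) (by exact_mod_cast (hM.upper t ht).ne')
  rw [div_eq_iff hne, hz, mul_comm]
  have hw := hM.sub_conjTranspose hI0
  have hl : a.length = σ.length + 1 := by omega
  -- At `t = 0` no slope is available when `I = {0}`, but there the `M`-loops suffice.
  rcases eq_or_ne t 0 with rfl | ht0
  · rw [hK.initial _ _ (by omega) (by simp; omega), hK.initial _ _ (by omega) (by simp; omega),
      Finset.sum_congr rfl fun b _ => hK.initial _ _ (by simp; omega) (by simp; omega),
      PrimitiveLoop.mLoop_ward hw hl]
  · obtain ⟨κ, hκ, hzt⟩ := hM.exists_slope hI0 ht ht0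
    have key := (hK.isLoopFamily.mono (hI.out hI0 ht)).ward hM.symmetric (κ := κ) hw
      (fun s d => by simpa [PrimitiveLoop.mLoop_singleton, PrimitiveLoop.chargedMatrix] using hκ d)
      (Set.right_mem_Icc.2 (hIpos t ht)) hl
    have ha2 : 2 ≤ a.length := by omega
    simpa [ha2, Nat.le_succ_of_le ha2, hzt, show 1 ≤ a.length by omega] using key
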